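/- For real $r\ge 0$ and integers $0\le k\le n$, let $\left[{n\atop k}\right]_r=\sum_{i=k}^n \left[{n\atop i}\right]\binom{i}{k} r^{i-k}$ and $\left\{{n\atop k}\right\}_r=\sum_{i=k}^n \binom{n}{i}\left\{{i\atop k}\right\} r^{n-i}$ (with $0^0=1$) be the $r$-Stirling numbers of the first and second kind, where $\left[{n\atop i}\right]$ is the number of permutations of $n$ elements with exactly $i$ cycles and $\left\{{i\atop k}\right\}$ is the number of partitions of an $i$-element set into $k$ non-empty blocks. Let $L(n,k)_r=\sum_{j=k}^n \left[{n\atop j}\right]_r\left\{{j\atop k}\right\}_r$. For $n\in\mathbb N$, $k\in\{0,\dots,n\}$ and $r\in[0,\infty)$ with $\max\{k,r\}>0$, a random variable $\mathrm{Lah}(n,k)_r$ has the $r$-Lah distribution if $$\mathbb P[\mathrm{Lah}(n,k)_r=j]=\frac{1}{L(n,k)_r}\left[{n\atop j}\right]_r\left\{{j\atop k}\right\}_r,\qquad j\in\{k,k+1,\dots,n\}.$$ **Theorem (Local limit theorem).** For every fixed $k\in\mathbb N_0$ and $r\in[0,\infty)$ such that $\max\{k,r\}>0$, $$\sqrt{\log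 n}\;\sup_{j\in\mathbb Z}\left|\,\mathbb P[\mathrm{Lah}(n,k)_r=j]-\frac{1}{\sqrt{2\pi(k+r)\log n}}\exp\left\{-\frac{(j-(k+r)\log n)^2}{2(k+r)\log n}\right\}\right|\longrightarrow 0\qquad\text{as } n\to\infty .$$ -/

import Mathlib

/-- The `r`-Stirling number of the first kind `[n, k]_r` (Nyul–Rácz indexing), for real `r`:
`∑_{j=k}^n [n, j] * (j choose k) * r ^ (j - k)`, where `[n, j]` is the number of permutations
of `n` elements with `j` cycles.  It is `0` for `k > n`. -/
noncomputable def rStirlingFirst (r : ℝ) (n k : ℕ) : ℝ :=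
  ∑ j ∈ Finset.Icc k n, (Nat.stirlingFirst n j : ℝ) * (Nat.choose j k : ℝ) * r ^ (j - k)

/-- The `r`-Stirling number of the second kind `{n, k}_r` (Nyul–Rácz indexing), for real `r`:
`∑_{j=k}^n (n choose j) * {j, k} * r ^ (n - j)`, where `{j, k}` is the number of partitions
of `j` elements into `k` non-empty blocks.  It is `0` for `k > n`. -/
noncomputable def rStirlingSecond (r : ℝ) (n k : ℕ) : ℝ :=
  ∑ j ∈ Finset.Icc k n, (Nat.choose n j : ℝ) * (Nat.stirlingSecond j k : ℝ) * r ^ (n - j)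

/-- The `r`-Lah number `L(n, k)_r`. -/
noncomputable def rLahNumber (r : ℝ) (n k : ℕ) : ℝ :=
  ∑ j ∈ Finset.Icc k n, rStirlingFirst r n j * rStirlingSecond r j k

/-- The `r`-Lah distribution with parameters `n`, `k` and `r`, as a measure on `ℤ`: it gives mass
`[n, j]_r * {j, k}_r / L(n, k)_r` to each `j ∈ {k, …, n}` and no mass to any other integer. -/
noncomputable def rLahMeasure (n k : ℕ) (r : ℝ) : MeasureTheory.Measure ℤ :=
  ∑ j ∈ Finset.Icc k n,
    ENNReal.ofReal (rStirlingFirst r n j * rStirlingSecond r j k / rLahNumber r n k) •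
      MeasureTheory.Measure.dirac (j : ℤ)

theorem rStirlingFirst_nonneg {r : ℝ} (hr : 0 ≤ r) (n k : ℕ) : 0 ≤ rStirlingFirst r n k := by
  unfold rStirlingFirst
  positivity

theorem rStirlingSecond_nonneg {r : ℝ} (hr : 0 ≤ r) (n k : ℕ) : 0 ≤ rStirlingSecond r n k := by
  unfold rStirlingSecond
  positivity

theorem stirlingSecond_pos_aux : ∀ {n k : ℕ}, 1 ≤ k → k ≤ n → 0 < Nat.stirlingSecond n k
  | 0, k, h1, h2 => by omega
  | n + 1, 0, h1, h2 => by omega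
  | n + 1, k + 1, h1, h2 => by
    rw [Nat.stirlingSecond_succ_succ]
    rcases Nat.lt_or_ge n (k + 1) with h | h
    · obtain rfl : n = k := by omega
      simp [Nat.stirlingSecond_self]
    · have := stirlingSecond_pos_aux h1 h
      positivity

theorem rLahNumber_pos {n k : ℕ} {r : ℝ} (hkn : k ≤ n) (hr : 0 ≤ r)
    (hkr : 0 < max (k : ℝ) r) : 0 < rLahNumber r n k := by
  have hfirst : rStirlingFirst r n n = 1 := by simp [rStirlingFirst, Nat.stirlingFirst_self]
  have hsecond : 0 < rStirlingSecond r n k := by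
    rcases Nat.eq_zero_or_pos k with rfl | hk
    · have hr' : 0 < r := by simpa using hkr
      refine lt_of_lt_of_le (pow_pos hr' n) ?_
      have := Finset.single_le_sum (s := Finset.Icc 0 n)
        (f := fun j ↦ (Nat.choose n j : ℝ) * (Nat.stirlingSecond j 0 : ℝ) * r ^ (n - j))
        (fun j _ ↦ by positivity) (Finset.mem_Icc.2 ⟨le_rfl, hkn⟩)
      simpa [rStirlingSecond] using this
    · have hpos : (0 : ℝ) < Nat.stirlingSecond n k := by
        exact_mod_cast stirlingSecond_pos_aux hk hkn
      refine lt_of_lt_of_le hpos ?_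
      have := Finset.single_le_sum (s := Finset.Icc k n)
        (f := fun j ↦ (Nat.choose n j : ℝ) * (Nat.stirlingSecond j k : ℝ) * r ^ (n - j))
        (fun j _ ↦ by positivity) (Finset.mem_Icc.2 ⟨hkn, le_rfl⟩)
      simpa [rStirlingSecond] using this
  refine lt_of_lt_of_le hsecond ?_
  have := Finset.single_le_sum (s := Finset.Icc k n)
    (f := fun j ↦ rStirlingFirst r n j * rStirlingSecond r j k)
    (fun j _ ↦ mul_nonneg (rStirlingFirst_nonneg hr _ _) (rStirlingSecond_nonneg hr _ _))
    (Finset.mem_Icc.2 ⟨hkn, le_rfl⟩)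
  simpa [rLahNumber, hfirst] using this

/-- The `r`-Lah distribution is a probability measure for every admissible triple. -/
theorem isProbabilityMeasure_rLahMeasure {n k : ℕ} {r : ℝ} (hkn : k ≤ n) (hr : 0 ≤ r)
    (hkr : 0 < max (k : ℝ) r) : MeasureTheory.IsProbabilityMeasure (rLahMeasure n k r) := by
  have hL := rLahNumber_pos hkn hr hkr
  constructor
  simp only [rLahMeasure, MeasureTheory.Measure.coe_finsetSum, MeasureTheory.Measure.smul_apply,
    Finset.sum_apply, MeasureTheory.measure_univ, smul_eq_mul, mul_one]
  rw [← ENNReal.ofReal_sum_of_nonneg, ← Finset.sum_div]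
  · change ENNReal.ofReal (rLahNumber r n k / rLahNumber r n k) = 1
    rw [div_self hL.ne', ENNReal.ofReal_one]
  · intro j _
    exact div_nonneg
      (mul_nonneg (rStirlingFirst_nonneg hr _ _) (rStirlingSecond_nonneg hr _ _)) hL.le

/-! Put `a = k + r`. Inclusion–exclusion writes `k! {j,k}_r` as an alternating sum of `(i + r)^j`
over `i ≤ k`, and `∑ [n,j]_r x^j = ∏ (x + r + m)` over `m < n`. The terms with `i < k` contribute
products smaller by a factor `O(1/n)` than the product for `i = k`. Hence, uniformly in `j`, the Lah
probabilities differ by `O(1/n)` from the tilted weights `[n,j]_r a^j / ∏ (a + r + m)`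
(`exists_rLah_sub_tilted_le`).

The tilted weights are the law of a sum of independent Bernoulli variables with parameters `p_m = a
/ (a + r + m)`, because their generating polynomial factors. Here `∑ p_m = a log n + O(1)` while `∑
p_m ^ 2` converges, so mean and variance are both `a log n + O(1)`. The rescaled characteristic
functions converge to the Gaussian one and are dominated by a fixed Gaussian; Fourier inversion
turns this into uniform convergence of point masses (`exists_localLimit_bound`,
`exists_localLimit_bound_rStirlingFirst`). -/

/-! ### Generating polynomials and inclusion–exclusion formulas. -/

open Finset in
theorem sum_stirlingFirst_mul_pow {R : Type*} [CommSemiring R] (x : R) (n : ℕ) :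
    ∑ j ∈ range (n + 1), (Nat.stirlingFirst n j : R) * x ^ j = ∏ m ∈ range n, (x + m) := by
  induction n with
  | zero => simp
  | succ n ih =>
    have h0 : ∑ j ∈ range (n + 1), (Nat.stirlingFirst n (j + 1) : R) * x ^ (j + 1) * n
        = ∑ j ∈ range (n + 1), (Nat.stirlingFirst n j : R) * x ^ j * n := by
      have h1 := sum_range_succ' (fun j ↦ (Nat.stirlingFirst n j : R) * x ^ j * n) (n + 1)
      rw [sum_range_succ, Nat.stirlingFirst_eq_zero_of_lt (Nat.lt_succ_self n)] at h1
      have h2 : (Nat.stirlingFirst n 0 : R) * n = 0 := by cases n <;> simp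
      simpa [h2] using h1.symm
    rw [prod_range_succ, ← ih, sum_range_succ', mul_add, sum_mul, sum_mul, ← h0]
    simp only [Nat.stirlingFirst_succ_zero, Nat.stirlingFirst_succ_succ, Nat.cast_zero, zero_mul,
      add_zero, ← sum_add_distrib]
    refine sum_congr rfl fun j _ ↦ ?_
    push_cast
    ring

open Finset in
/-- The generating polynomial of the `r`-Stirling numbers of the first kind. -/
theorem sum_rStirlingFirst_mul_pow (r : ℝ) (x : ℂ) (n : ℕ) :
    ∑ j ∈ range (n + 1), (rStirlingFirst r n j : ℂ) * x ^ j
      = ∏ m ∈ range n, (x + r + m) := by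
  rw [← sum_stirlingFirst_mul_pow]
  simp only [rStirlingFirst, Complex.ofReal_sum, sum_mul]
  rw [sum_comm' (t' := range (n + 1)) (s' := fun i ↦ range (i + 1))]
  · refine sum_congr rfl fun i _ ↦ ?_
    rw [add_pow, mul_sum]
    refine sum_congr rfl fun j _ ↦ ?_
    push_cast
    ring
  · intro i j
    simp only [mem_range, mem_Icc]
    omega

open Finset in
theorem sum_rStirlingFirst_mul_pow_real (r x : ℝ) (n : ℕ) :
    ∑ j ∈ range (n + 1), rStirlingFirst r n j * x ^ j = ∏ m ∈ range n, (x + r + m) := by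
  exact_mod_cast sum_rStirlingFirst_mul_pow r x n

-- Both sides count surjections from `n` points onto `k` points. The sign exponent `k + i` replaces
-- `k - i` to avoid truncated subtraction.
open Finset in
theorem factorial_mul_stirlingSecond (n k : ℕ) :
    (k.factorial : ℝ) * Nat.stirlingSecond n k
      = ∑ i ∈ range (k + 1), (-1) ^ (k + i) * (k.choose i : ℝ) * (i : ℝ) ^ n := by
  induction n generalizing k with
  | zero =>
    have h := Commute.all (1 : ℝ) (-1) |>.add_pow k
    -- The term `i = 0` counts here, since `0 ^ 0 = 1`.
    have h2 : ∑ i ∈ range (k + 1), (-1 : ℝ) ^ (k + i) * (k.choose i : ℝ) * (i : ℝ) ^ 0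
        = (1 + -1) ^ k := by
      rw [h]
      refine sum_congr rfl fun i hi ↦ ?_
      have hi' : i ≤ k := by simpa [Nat.lt_succ_iff] using hi
      obtain ⟨d, rfl⟩ := Nat.exists_eq_add_of_le hi'
      have : (-1 : ℝ) ^ (i + d + i) = (-1) ^ d := by
        rw [show i + d + i = 2 * i + d by ring, pow_add, pow_mul]; simp
      rw [this]
      simp
    rw [h2]
    cases k <;> simp
  | succ n ih =>
    cases k with
    | zero => simp
    | succ k =>
      have h1 := ih (k + 1)
      have h2 := ih k
      -- Absorbing one factor `i` of `i ^ (n + 1)` this way reproduces the recurrence of the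
      -- Stirling numbers.
      have key : ∀ i : ℕ, (i : ℝ) * ((k + 1).choose i : ℝ)
          = (k + 1) * (((k + 1).choose i : ℝ) - (k.choose i : ℝ)) := by
        intro i
        cases i with
        | zero => simp
        | succ i =>
          have h3 := Nat.add_one_mul_choose_eq k i
          have h4 : ((k : ℝ) + 1) * k.choose i = (k + 1).choose (i + 1) * ((i : ℝ) + 1) := by
            exact_mod_cast h3
          rw [Nat.choose_succ_succ'] at h4 ⊢
          push_cast at h4 ⊢
          linarith
      have h3 : ∑ i ∈ range (k + 2), (-1 : ℝ) ^ (k + 1 + i) * (k.choose i : ℝ) * (i : ℝ) ^ n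
          = -∑ i ∈ range (k + 1), (-1 : ℝ) ^ (k + i) * (k.choose i : ℝ) * (i : ℝ) ^ n := by
        rw [sum_range_succ, Nat.choose_eq_zero_of_lt (Nat.lt_succ_self k), ← sum_neg_distrib]
        simp only [Nat.cast_zero, mul_zero, zero_mul, add_zero]
        refine sum_congr rfl fun i _ ↦ ?_
        rw [show k + 1 + i = k + i + 1 by ring, pow_succ]
        ring
      have h4 : ∑ i ∈ range (k + 2),
            (-1 : ℝ) ^ (k + 1 + i) * ((k + 1).choose i : ℝ) * (i : ℝ) ^ (n + 1)
          = (k + 1) * ((∑ i ∈ range (k + 2),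
              (-1 : ℝ) ^ (k + 1 + i) * ((k + 1).choose i : ℝ) * (i : ℝ) ^ n)
            - ∑ i ∈ range (k + 2),
              (-1 : ℝ) ^ (k + 1 + i) * (k.choose i : ℝ) * (i : ℝ) ^ n) := by
        rw [← sum_sub_distrib, mul_sum]
        refine sum_congr rfl fun i _ ↦ ?_
        linear_combination ((-1 : ℝ) ^ (k + 1 + i) * (i : ℝ) ^ n) * key i
      rw [h4, h3, ← h1, ← h2, Nat.stirlingSecond_succ_succ, Nat.factorial_succ]
      push_cast
      ring

-- Expand `(i + r) ^ n` binomially and apply the case `r = 0` to each power of `i`.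
open Finset in
theorem factorial_mul_rStirlingSecond (r : ℝ) (n k : ℕ) :
    (k.factorial : ℝ) * rStirlingSecond r n k
      = ∑ i ∈ range (k + 1), (-1) ^ (k + i) * (k.choose i : ℝ) * (i + r) ^ n := by
  have h : rStirlingSecond r n k = ∑ j ∈ range (n + 1),
      (Nat.choose n j : ℝ) * (Nat.stirlingSecond j k : ℝ) * r ^ (n - j) := by
    refine sum_subset (fun j ↦ ?_) (fun j hj hj' ↦ ?_)
    · simp only [mem_range, mem_Icc]
      omega
    · simp only [mem_range, mem_Icc] at hj hj'
      rw [Nat.stirlingSecond_eq_zero_of_lt (by omega)]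
      simp
  simp_rw [h, add_pow, mul_sum]
  rw [sum_comm]
  refine sum_congr rfl fun j _ ↦ ?_
  rw [show (k.factorial : ℝ) * ((n.choose j : ℝ) * (Nat.stirlingSecond j k : ℝ) * r ^ (n - j))
    = (n.choose j : ℝ) * r ^ (n - j) * (k.factorial * Nat.stirlingSecond j k) by ring,
    factorial_mul_stirlingSecond, mul_sum]
  refine sum_congr rfl fun i _ ↦ ?_
  ring

theorem rStirlingFirst_eq_zero_of_lt (r : ℝ) {n k : ℕ} (h : n < k) : rStirlingFirst r n k = 0 := by
  simp [rStirlingFirst, Finset.Icc_eq_empty_of_lt h]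

theorem rStirlingSecond_eq_zero_of_lt (r : ℝ) {n k : ℕ} (h : n < k) :
    rStirlingSecond r n k = 0 := by
  simp [rStirlingSecond, Finset.Icc_eq_empty_of_lt h]

-- After exchanging sums, the inner sum is the generating polynomial of the first-kind numbers at `i
-- + r`.
open Finset in
theorem factorial_mul_rLahNumber (r : ℝ) (n k : ℕ) :
    (k.factorial : ℝ) * rLahNumber r n k
      = ∑ i ∈ range (k + 1), (-1) ^ (k + i) * (k.choose i : ℝ) *
          ∏ m ∈ range n, ((i + r : ℝ) + r + m) := by
  have h : rLahNumber r n k = ∑ j ∈ range (n + 1), rStirlingFirst r n j * rStirlingSecond r j k := by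
    refine sum_subset (fun j ↦ ?_) (fun j hj hj' ↦ ?_)
    · simp only [mem_range, mem_Icc]
      omega
    · simp only [mem_range, mem_Icc] at hj hj'
      rw [rStirlingSecond_eq_zero_of_lt r (by omega), mul_zero]
  simp_rw [← sum_rStirlingFirst_mul_pow_real, h, mul_sum]
  rw [sum_comm]
  refine sum_congr rfl fun j _ ↦ ?_
  rw [mul_left_comm, factorial_mul_rStirlingSecond, mul_sum]
  refine sum_congr rfl fun i _ ↦ ?_
  ring

/-! ### Point masses of the `r`-Lah distribution. -/

open MeasureTheory in
/-- The point masses of the `r`-Lah distribution, indexed by natural numbers. -/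
theorem rLahMeasure_real_singleton_natCast {n k : ℕ} {r : ℝ} (hr : 0 ≤ r) (j : ℕ) :
    (rLahMeasure n k r).real {(j : ℤ)}
      = rStirlingFirst r n j * rStirlingSecond r j k / rLahNumber r n k := by
  have hL : 0 ≤ rLahNumber r n k := Finset.sum_nonneg fun j _ ↦
    mul_nonneg (rStirlingFirst_nonneg hr _ _) (rStirlingSecond_nonneg hr _ _)
  have hm : (rLahMeasure n k r) {(j : ℤ)} = ENNReal.ofReal
      (rStirlingFirst r n j * rStirlingSecond r j k / rLahNumber r n k) := by
    simp only [rLahMeasure, Measure.coe_finsetSum, Measure.smul_apply, Finset.sum_apply,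
      smul_eq_mul, Measure.dirac_apply, Set.indicator_apply, Set.mem_singleton_iff, Nat.cast_inj,
      Pi.one_apply, mul_ite, mul_one, mul_zero, Finset.sum_ite_eq', Finset.mem_Icc]
    split_ifs with h
    · rfl
    · rcases not_and_or.1 h with h | h
      · simp [rStirlingSecond_eq_zero_of_lt r (not_le.1 h)]
      · simp [rStirlingFirst_eq_zero_of_lt r (not_le.1 h)]
  rw [Measure.real, hm, ENNReal.toReal_ofReal]
  exact div_nonneg (mul_nonneg (rStirlingFirst_nonneg hr _ _) (rStirlingSecond_nonneg hr _ _)) hL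

open MeasureTheory in
theorem rLahMeasure_real_singleton_of_neg (n k : ℕ) (r : ℝ) {j : ℤ} (hj : j < 0) :
    (rLahMeasure n k r).real {j} = 0 := by
  have h : ∀ i : ℕ, (i : ℤ) ≠ j := fun i ↦ by omega
  simp [Measure.real, rLahMeasure, h]

/-! ### Fourier inversion and an abstract local limit theorem. -/

open Finset in
/-- Fourier inversion for trigonometric polynomials. -/
theorem integral_cexp_mul_sum_cexp_pow (c : ℕ → ℂ) (N : ℕ) (j : ℤ) :
    ∫ t in -Real.pi..Real.pi, Complex.exp (-(j * t * Complex.I)) *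
        ∑ l ∈ range N, c l * Complex.exp (t * Complex.I) ^ l
      = 2 * Real.pi * ∑ l ∈ range N, if (l : ℤ) = j then c l else 0 := by
  have h1 : ∀ l : ℕ, ∫ t : ℝ in -Real.pi..Real.pi, Complex.exp (((l - j : ℤ) * Complex.I) * t)
      = if (l : ℤ) = j then 2 * (Real.pi : ℂ) else 0 := by
    intro l
    split_ifs with h
    · simp only [h, sub_self, Int.cast_zero, zero_mul, Complex.exp_zero,
        intervalIntegral.integral_const, Complex.real_smul, mul_one]
      push_cast
      ring
    · have h0 : (((l - j : ℤ) : ℂ) * Complex.I) ≠ 0 :=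
        mul_ne_zero (Int.cast_ne_zero.2 (sub_ne_zero.2 h)) Complex.I_ne_zero
      rw [integral_exp_mul_complex h0]
      have h2 : ((l - j : ℤ) : ℂ) * Complex.I * (Real.pi : ℝ)
          = ((l - j : ℤ) : ℂ) * Complex.I * ((-Real.pi : ℝ) : ℂ)
            + (l - j : ℤ) * (2 * Real.pi * Complex.I) := by
        push_cast
        ring
      rw [h2, Complex.exp_periodic.int_mul (l - j), sub_self, zero_div]
  have h2 : ∀ t : ℝ, Complex.exp (-(j * t * Complex.I)) *
        ∑ l ∈ range N, c l * Complex.exp (t * Complex.I) ^ l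
      = ∑ l ∈ range N, c l * Complex.exp (((l - j : ℤ) * Complex.I) * t) := by
    intro t
    rw [mul_sum]
    refine sum_congr rfl fun l _ ↦ ?_
    rw [← Complex.exp_nat_mul, mul_left_comm, ← Complex.exp_add]
    congr 2
    push_cast
    ring
  simp_rw [h2]
  rw [intervalIntegral.integral_finsetSum]
  · simp_rw [intervalIntegral.integral_const_mul, h1, mul_sum]
    refine sum_congr rfl fun l _ ↦ ?_
    split_ifs <;> ring
  · intro l _
    exact Continuous.intervalIntegrable (by fun_prop) _ _

theorem integral_cexp_mul_gaussian (x : ℝ) :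
    ∫ u : ℝ, Complex.exp (-(x * u * Complex.I)) * (Real.exp (-(u ^ 2 / 2)) : ℂ)
      = (Real.sqrt (2 * Real.pi) * Real.exp (-(x ^ 2 / 2)) : ℝ) := by
  have h := fourierIntegral_gaussian (b := 1 / 2) (by norm_num) (-x : ℂ)
  have h2 : ((Real.pi : ℂ) / (1 / 2)) ^ (1 / 2 : ℂ) = (Real.sqrt (2 * Real.pi) : ℝ) := by
    rw [Real.sqrt_eq_rpow, Complex.ofReal_cpow (by positivity)]
    push_cast
    congr 1
    ring
  rw [h2] at h
  push_cast
  rw [show -((x : ℂ) ^ 2 / 2) = -(-(x : ℂ)) ^ 2 / (4 * (1 / 2)) by ring, ← h]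
  refine MeasureTheory.integral_congr_ae (Filter.Eventually.of_forall fun u ↦ ?_)
  simp only
  congr 2 <;> ring

open Finset Filter Topology MeasureTheory in
/-- A local limit theorem: a Gaussian domination of the characteristic functions upgrades their
pointwise convergence to uniform convergence of the rescaled point masses. -/
theorem exists_localLimit_bound {c : ℕ → ℕ → ℝ} {N : ℕ → ℕ} {s μ : ℕ → ℝ} {δ : ℝ} (hδ : 0 < δ)
    (hs : Tendsto s atTop atTop)
    (hbound : ∀ᶠ n in atTop, ∀ t : ℝ, |t| ≤ Real.pi →
      ‖∑ l ∈ range (N n), (c n l : ℂ) * Complex.exp (t * Complex.I) ^ l‖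
        ≤ Real.exp (-δ * (s n * t) ^ 2))
    (hlim : ∀ u : ℝ, Tendsto (fun n ↦ Complex.exp (-(μ n * (u / s n : ℝ) * Complex.I)) *
      ∑ l ∈ range (N n), (c n l : ℂ) * Complex.exp ((u / s n : ℝ) * Complex.I) ^ l)
      atTop (𝓝 (Real.exp (-(u ^ 2 / 2)) : ℂ))) :
    ∃ ε : ℕ → ℝ, Tendsto ε atTop (𝓝 0) ∧ ∀ᶠ n in atTop, ∀ j : ℤ,
      |s n * (∑ l ∈ range (N n), if (l : ℤ) = j then c n l else 0)
        - Real.exp (-(((j - μ n) / s n) ^ 2 / 2)) / Real.sqrt (2 * Real.pi)| ≤ ε n := by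
  set φ : ℕ → ℝ → ℂ := fun n t ↦
    ∑ l ∈ range (N n), (c n l : ℂ) * Complex.exp (t * Complex.I) ^ l with hφ
  have hφc : ∀ n, Continuous (φ n) := fun n ↦ by
    simp only [hφ]
    fun_prop
  set f : ℕ → ℝ → ℂ := fun n u ↦ Complex.exp (-(μ n * (u / s n : ℝ) * Complex.I)) * φ n (u / s n)
    with hf
  have hfc : ∀ n, Continuous (f n) := fun n ↦ by
    simp only [hf]
    have := (hφc n).comp (continuous_id.div_const (s n))
    simp only [Function.comp_def, id] at this
    fun_prop
  -- One period `(-π, π]` in the variable `u = s n * t`; truncating to it allows integration over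
  -- the whole line.
  set A : ℕ → Set ℝ := fun n ↦ Set.Ioc (-(Real.pi * s n)) (Real.pi * s n) with hA
  have hAm : ∀ n, MeasurableSet (A n) := fun n ↦ measurableSet_Ioc
  set F : ℕ → ℝ → ℂ := fun n ↦ (A n).indicator (f n) with hF
  set g : ℝ → ℂ := fun u ↦ (Real.exp (-(u ^ 2 / 2)) : ℂ) with hg
  have hgc : Continuous g := by simp only [hg]; fun_prop
  have hgi : Integrable g := by
    have := integrable_exp_neg_mul_sq (b := 1 / 2) (by norm_num)
    refine (this.congr (Eventually.of_forall fun u ↦ ?_)).ofReal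
    simp only
    congr 1
    ring
  have hFm : ∀ n, AEStronglyMeasurable (F n) := fun n ↦
    (hfc n).aestronglyMeasurable.indicator (hAm n)
  have hFb : ∀ᶠ n in atTop, ∀ u, ‖F n u‖ ≤ Real.exp (-δ * u ^ 2) := by
    filter_upwards [hbound, hs.eventually_gt_atTop 0] with n hn hsn u
    by_cases hu : u ∈ A n
    · simp only [hF, Set.indicator_of_mem hu, hf, norm_mul]
      have h1 : ‖Complex.exp (-(μ n * (u / s n : ℝ) * Complex.I))‖ = 1 := by
        rw [show -((μ n : ℂ) * (u / s n : ℝ) * Complex.I)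
          = ((-(μ n * (u / s n)) : ℝ) : ℂ) * Complex.I by push_cast; ring]
        exact Complex.norm_exp_ofReal_mul_I _
      have h2 := hn (u / s n) (by
        rw [abs_div, abs_of_pos hsn, div_le_iff₀ hsn]
        exact abs_le.2 ⟨hu.1.le, hu.2⟩)
      rw [h1, one_mul]
      rwa [mul_div_cancel₀ u hsn.ne'] at h2
    · simp only [hF, Set.indicator_of_notMem hu, norm_zero]
      positivity
  have hFi : ∀ᶠ n in atTop, Integrable (F n) := by
    filter_upwards [hFb] with n hn
    exact (integrable_exp_neg_mul_sq hδ).mono' (hFm n) (Eventually.of_forall hn)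
  have hFl : ∀ u, Tendsto (fun n ↦ F n u) atTop (𝓝 (g u)) := by
    intro u
    refine (hlim u).congr' ?_
    filter_upwards [hs.eventually_gt_atTop (|u| / Real.pi)] with n hn
    have h1 : |u| < Real.pi * s n := by
      rwa [div_lt_iff₀ Real.pi_pos, mul_comm] at hn
    have hu : u ∈ A n := ⟨(abs_lt.1 h1).1, (abs_lt.1 h1).2.le⟩
    simp only [hF, Set.indicator_of_mem hu, hf, hφ]
  have hlimI : Tendsto (fun n ↦ ∫ u, ‖F n u - g u‖) atTop (𝓝 (∫ _ : ℝ, (0 : ℝ))) := by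
    refine tendsto_integral_filter_of_dominated_convergence
      (fun u ↦ Real.exp (-δ * u ^ 2) + ‖g u‖) ?_ ?_ ?_ ?_
    · exact Eventually.of_forall fun n ↦ ((hFm n).sub hgc.aestronglyMeasurable).norm
    · filter_upwards [hFb] with n hn
      refine Eventually.of_forall fun u ↦ ?_
      rw [norm_norm]
      exact (norm_sub_le _ _).trans (by gcongr; exact hn u)
    · exact (integrable_exp_neg_mul_sq hδ).add hgi.norm
    · refine Eventually.of_forall fun u ↦ ?_
      have := ((hFl u).sub_const (g u)).norm
      simpa using this
  -- The `L¹` distance is uniform in `j`, which enters the inversion integrals only through a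
  -- unimodular factor.
  refine ⟨fun n ↦ (∫ u, ‖F n u - g u‖) / (2 * Real.pi), ?_, ?_⟩
  · simpa using hlimI.div_const (2 * Real.pi)
  filter_upwards [hFi, hs.eventually_gt_atTop 0] with n hFin hsn j
  set x : ℝ := (j - μ n) / s n with hx
  have hint1 : ∫ u : ℝ, Complex.exp (-(x * u * Complex.I)) * F n u
      = ((2 * Real.pi * (s n * ∑ l ∈ range (N n), if (l : ℤ) = j then c n l else 0) : ℝ) : ℂ) := by
    have h1 : ∀ u : ℝ, Complex.exp (-(x * u * Complex.I)) * F n u = (A n).indicator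
        (fun u : ℝ ↦ Complex.exp (-(j * (u / s n : ℝ) * Complex.I)) * φ n (u / s n)) u := by
      intro u
      by_cases hu : u ∈ A n
      · simp only [hF, Set.indicator_of_mem hu, hf]
        rw [← mul_assoc, ← Complex.exp_add]
        congr 2
        rw [hx]
        push_cast
        ring
      · simp only [hF, Set.indicator_of_notMem hu, mul_zero]
    simp_rw [h1]
    rw [integral_indicator (hAm n), ← intervalIntegral.integral_of_le
      (by nlinarith [Real.pi_pos, mul_pos Real.pi_pos hsn]),
      intervalIntegral.integral_comp_div
        (fun t : ℝ ↦ Complex.exp (-(j * t * Complex.I)) * φ n t) hsn.ne',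
      neg_div, mul_div_cancel_right₀ _ hsn.ne']
    have h2 := integral_cexp_mul_sum_cexp_pow (fun l ↦ (c n l : ℂ)) (N n) j
    simp only [hφ]
    rw [h2, Complex.real_smul]
    push_cast
    have h3 : ∀ l : ℕ, ((if (l : ℤ) = j then c n l else 0 : ℝ) : ℂ)
        = if (l : ℤ) = j then (c n l : ℂ) else 0 := fun l ↦ by split_ifs <;> simp
    simp_rw [h3]
    ring
  have hint2 := integral_cexp_mul_gaussian x
  have hnorm : ∀ u : ℝ, ‖Complex.exp (-(x * u * Complex.I))‖ = 1 := fun u ↦ by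
    rw [show -((x : ℂ) * u * Complex.I) = ((-(x * u) : ℝ) : ℂ) * Complex.I by push_cast; ring]
    exact Complex.norm_exp_ofReal_mul_I _
  have hmulint : ∀ h : ℝ → ℂ, Integrable h →
      Integrable fun u : ℝ ↦ Complex.exp (-(x * u * Complex.I)) * h u := by
    intro h hh
    refine hh.norm.mono' ((Continuous.aestronglyMeasurable (by fun_prop)).mul
      hh.aestronglyMeasurable) (Eventually.of_forall fun u ↦ ?_)
    rw [norm_mul, hnorm, one_mul]
  have hdiff : ‖(∫ u : ℝ, Complex.exp (-(x * u * Complex.I)) * F n u)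
      - ∫ u : ℝ, Complex.exp (-(x * u * Complex.I)) * g u‖ ≤ ∫ u, ‖F n u - g u‖ := by
    rw [← integral_sub (hmulint _ hFin) (hmulint _ hgi)]
    refine (norm_integral_le_integral_norm _).trans_eq ?_
    refine integral_congr_ae (Eventually.of_forall fun u ↦ ?_)
    simp only
    rw [← mul_sub, norm_mul, hnorm, one_mul]
  simp only [hg] at hdiff
  rw [hint1, hint2, ← Complex.ofReal_sub, Complex.norm_real, Real.norm_eq_abs] at hdiff
  rw [le_div_iff₀ (by positivity), ← abs_of_pos (show (0 : ℝ) < 2 * Real.pi by positivity),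
    ← abs_mul, abs_of_pos (show (0 : ℝ) < 2 * Real.pi by positivity)]
  refine le_of_eq_of_le ?_ hdiff
  congr 1
  have hsq : Real.sqrt (2 * Real.pi) * Real.sqrt (2 * Real.pi) = 2 * Real.pi :=
    Real.mul_self_sqrt (by positivity)
  have hsp : Real.sqrt (2 * Real.pi) ≠ 0 := by positivity
  rw [sub_mul, div_mul_eq_mul_div]
  congr 1
  · ring
  · rw [div_eq_iff hsp]
    linear_combination (-Real.exp (-(x ^ 2 / 2))) * hsq

/-! ### Harmonic sums and products of Bernoulli characteristic functions. -/

theorem summable_one_div_add_natCast_sq (c : ℝ) : Summable fun m : ℕ ↦ (1 / (c + m)) ^ 2 := by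
  refine ((Real.summable_one_div_nat_add_rpow c 2).2 one_lt_two).congr fun m ↦ ?_
  rw [div_pow, one_pow, Real.rpow_two, sq_abs, add_comm]

open Finset in
/-- Shifted harmonic sums are logarithmic up to a bounded error. -/
theorem exists_abs_sum_one_div_add_sub_log_le {c : ℝ} (hc : 0 < c) :
    ∃ C : ℝ, 0 ≤ C ∧ ∀ n : ℕ, 1 ≤ n → |∑ m ∈ range n, 1 / (c + m) - Real.log n| ≤ C := by
  have hs1 := summable_one_div_add_natCast_sq c
  have hs2 := summable_one_div_add_natCast_sq 1
  -- The `1` compares the harmonic number with `log n`. The rest bounds the shift from `1` to `c`: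
  -- with `x = 1 / (c + m)` and `y = 1 / (1 + m)`, `x - y = (1 - c) x y` and `x y ≤ x ^ 2 + y ^ 2`.
  refine ⟨|1 - c| * ((∑' m : ℕ, (1 / (c + m)) ^ 2) + ∑' m : ℕ, (1 / (1 + m : ℝ)) ^ 2) + 1,
    by positivity, fun n hn ↦ ?_⟩
  have h1 : |(harmonic n : ℝ) - Real.log n| ≤ 1 := by
    have hn0 : (0 : ℝ) < n := by exact_mod_cast hn
    have h2 := harmonic_le_one_add_log n
    have h3 := log_add_one_le_harmonic n
    have h4 : Real.log n ≤ Real.log ((n + 1 : ℕ) : ℝ) :=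
      Real.log_le_log hn0 (by push_cast; linarith)
    exact abs_le.2 ⟨by linarith, by linarith⟩
  have h2 : (harmonic n : ℝ) = ∑ m ∈ range n, 1 / (1 + m : ℝ) := by
    simp [harmonic, add_comm]
  have h3 : |∑ m ∈ range n, 1 / (c + m) - ∑ m ∈ range n, 1 / (1 + m : ℝ)|
      ≤ |1 - c| * ((∑' m : ℕ, (1 / (c + m)) ^ 2) + ∑' m : ℕ, (1 / (1 + m : ℝ)) ^ 2) := by
    rw [← sum_sub_distrib]
    refine (abs_sum_le_sum_abs _ _).trans ?_
    calc ∑ m ∈ range n, |1 / (c + m) - 1 / (1 + m : ℝ)|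
        ≤ ∑ m ∈ range n, |1 - c| * ((1 / (c + m)) ^ 2 + (1 / (1 + m : ℝ)) ^ 2) := by
          refine sum_le_sum fun m _ ↦ ?_
          have hx : 0 < 1 / (c + m) := by positivity
          have hy : (0 : ℝ) < 1 / (1 + m : ℝ) := by positivity
          have h4 : 1 / (c + m) - 1 / (1 + m : ℝ)
              = (1 - c) * (1 / (c + m) * (1 / (1 + m : ℝ))) := by
            have : c + m ≠ 0 := by positivity
            have : (1 + m : ℝ) ≠ 0 := by positivity
            field_simp
            ring
          rw [h4, abs_mul, abs_of_pos (mul_pos hx hy)]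
          gcongr
          nlinarith [sq_nonneg (1 / (c + m) - 1 / (1 + m : ℝ)), mul_pos hx hy]
      _ = |1 - c| * (∑ m ∈ range n, (1 / (c + m)) ^ 2
            + ∑ m ∈ range n, (1 / (1 + m : ℝ)) ^ 2) := by
          rw [← mul_sum, sum_add_distrib]
      _ ≤ _ := by
          gcongr
          · exact hs1.sum_le_tsum _ fun _ _ ↦ sq_nonneg _
          · exact hs2.sum_le_tsum _ fun _ _ ↦ sq_nonneg _
  rw [← h2] at h3
  calc |∑ m ∈ range n, 1 / (c + m) - Real.log n|
      = |(∑ m ∈ range n, 1 / (c + m) - harmonic n) + (harmonic n - Real.log n)| := by ring_nf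
    _ ≤ _ := (abs_add_le _ _).trans (add_le_add h3 h1)

-- Telescoping: factors are exchanged one at a time, all others having norm at most `1`.
open Finset in
theorem norm_prod_sub_prod_le_sum {ι : Type*} (S : Finset ι) (f g : ι → ℂ)
    (hf : ∀ i ∈ S, ‖f i‖ ≤ 1) (hg : ∀ i ∈ S, ‖g i‖ ≤ 1) :
    ‖∏ i ∈ S, f i - ∏ i ∈ S, g i‖ ≤ ∑ i ∈ S, ‖f i - g i‖ := by
  classical
  induction S using Finset.induction_on with
  | empty => simp
  | insert i S hi ih =>
    rw [prod_insert hi, prod_insert hi, sum_insert hi]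
    have ih' := ih (fun j hj ↦ hf j (mem_insert_of_mem hj)) (fun j hj ↦ hg j (mem_insert_of_mem hj))
    have h1 : ‖∏ j ∈ S, f j‖ ≤ 1 := by
      rw [norm_prod]
      exact prod_le_one (fun _ _ ↦ norm_nonneg _) fun j hj ↦ hf j (mem_insert_of_mem hj)
    have h2 := hg i (mem_insert_self i S)
    calc ‖f i * ∏ j ∈ S, f j - g i * ∏ j ∈ S, g j‖
        = ‖(f i - g i) * ∏ j ∈ S, f j + g i * (∏ j ∈ S, f j - ∏ j ∈ S, g j)‖ := by ring_nf
      _ ≤ ‖f i - g i‖ * ‖∏ j ∈ S, f j‖ + ‖g i‖ * ‖∏ j ∈ S, f j - ∏ j ∈ S, g j‖ := by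
          refine (norm_add_le _ _).trans_eq ?_
          rw [norm_mul, norm_mul]
      _ ≤ ‖f i - g i‖ * 1 + 1 * ∑ j ∈ S, ‖f j - g j‖ := by gcongr
      _ = _ := by ring

/-- The characteristic function of a Bernoulli variable. -/
theorem norm_one_add_mul_cexp_sub_one_le (p t : ℝ) :
    ‖1 + (p : ℂ) * (Complex.exp (t * Complex.I) - 1)‖
      ≤ Real.exp (-(p * (1 - p) * (1 - Real.cos t))) := by
  rw [← abs_of_pos (Real.exp_pos _), ← abs_norm, ← sq_le_sq, ← Complex.normSq_eq_norm_sq,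
    ← Real.exp_nat_mul, Complex.exp_mul_I, Complex.normSq_apply, ← Complex.ofReal_cos,
    ← Complex.ofReal_sin]
  simp only [Complex.add_re, Complex.add_im, Complex.mul_re, Complex.mul_im, Complex.sub_re,
    Complex.sub_im, Complex.one_re, Complex.one_im, Complex.ofReal_re, Complex.ofReal_im,
    Complex.I_re, Complex.I_im]
  -- The squared modulus equals `1 - 2 p (1 - p) (1 - cos t)`.
  have h1 := Real.add_one_le_exp (((2 : ℕ) : ℝ) * -(p * (1 - p) * (1 - Real.cos t)))
  refine le_trans (le_of_eq ?_) h1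
  push_cast
  linear_combination (p ^ 2) * Real.sin_sq_add_cos_sq t

/-- The exponential is the characteristic function of a Poisson variable of mean `p`. -/
theorem norm_cexp_mul_cexp_sub_one_le_one {p : ℝ} (hp : 0 ≤ p) (t : ℝ) :
    ‖Complex.exp ((p : ℂ) * (Complex.exp (t * Complex.I) - 1))‖ ≤ 1 := by
  rw [Complex.norm_exp, Real.exp_le_one_iff, Complex.re_ofReal_mul, Complex.sub_re,
    Complex.exp_ofReal_mul_I_re, Complex.one_re]
  exact mul_nonpos_of_nonneg_of_nonpos hp (by linarith [Real.cos_le_one t])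

theorem norm_cexp_ofReal_mul_I_sub_one_le (t : ℝ) : ‖Complex.exp (t * Complex.I) - 1‖ ≤ |t| := by
  rw [mul_comm]
  exact Real.norm_exp_I_mul_ofReal_sub_one_le

open Finset Filter Topology in
/-- A product of characteristic functions of Bernoulli variables converges to the Gaussian one, if
the squared parameters are summable and the sum of the parameters is close to `s ^ 2`. -/
theorem tendsto_prod_bernoulli_charFun {p : ℕ → ℝ} (hp0 : ∀ m, 0 ≤ p m) (hp1 : ∀ m, p m ≤ 1)
    (hp2 : Summable fun m ↦ p m ^ 2) {s : ℕ → ℝ} (hs : Tendsto s atTop atTop) {C : ℝ}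
    (hC : ∀ᶠ n in atTop, |∑ m ∈ range n, p m - s n ^ 2| ≤ C) (u : ℝ) :
    Tendsto (fun n ↦ Complex.exp (-((s n ^ 2 : ℝ) * (u / s n : ℝ) * Complex.I)) *
      ∏ m ∈ range n, (1 + (p m : ℂ) * (Complex.exp ((u / s n : ℝ) * Complex.I) - 1)))
      atTop (𝓝 (Real.exp (-(u ^ 2 / 2)) : ℂ)) := by
  have ht : Tendsto (fun n ↦ u / s n) atTop (𝓝 0) := hs.const_div_atTop u
  have ht1 : ∀ᶠ n in atTop, |u / s n| ≤ 1 := by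
    have := ht.abs
    rw [abs_zero] at this
    exact this.eventually_le_const one_pos
  set z : ℕ → ℂ := fun n ↦ Complex.exp ((u / s n : ℝ) * Complex.I) - 1 with hz
  have hzt : ∀ n, ‖z n‖ ≤ |u / s n| := fun n ↦ norm_cexp_ofReal_mul_I_sub_one_le _
  have hz0 : Tendsto z atTop (𝓝 0) := by
    refine squeeze_zero_norm hzt ?_
    simpa using ht.abs
  -- Poisson approximation: exchanging the `m`-th factor costs at most `p m ^ 2 * |u / s n| ^ 2`,
  -- which is summable in `m`.
  have hA : Tendsto (fun n ↦ ∏ m ∈ range n, (1 + (p m : ℂ) * z n)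
      - Complex.exp ((∑ m ∈ range n, p m : ℝ) * z n)) atTop (𝓝 0) := by
    refine squeeze_zero_norm' (a := fun n ↦ (∑' m, p m ^ 2) * |u / s n| ^ 2) ?_ ?_
    · filter_upwards [ht1] with n hn
      have h1 : Complex.exp ((∑ m ∈ range n, p m : ℝ) * z n)
          = ∏ m ∈ range n, Complex.exp (p m * z n) := by
        rw [← Complex.exp_sum, ← sum_mul]
        push_cast
        rfl
      rw [h1]
      refine (norm_prod_sub_prod_le_sum _ _ _ (fun m _ ↦ ?_)
        (fun m _ ↦ norm_cexp_mul_cexp_sub_one_le_one (hp0 m) _)).trans ?_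
      · refine (norm_one_add_mul_cexp_sub_one_le _ _).trans (Real.exp_le_one_iff.2 ?_)
        have := mul_nonneg (mul_nonneg (hp0 m) (sub_nonneg.2 (hp1 m)))
          (sub_nonneg.2 (Real.cos_le_one (u / s n)))
        linarith
      · calc ∑ m ∈ range n, ‖1 + (p m : ℂ) * z n - Complex.exp (p m * z n)‖
            ≤ ∑ m ∈ range n, p m ^ 2 * |u / s n| ^ 2 := by
              refine sum_le_sum fun m _ ↦ ?_
              have h2 : ‖(p m : ℂ) * z n‖ ≤ p m * |u / s n| := by
                rw [norm_mul, Complex.norm_real, Real.norm_of_nonneg (hp0 m)]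
                exact mul_le_mul_of_nonneg_left (hzt n) (hp0 m)
              have h3 : p m * |u / s n| ≤ 1 := mul_le_one₀ (hp1 m) (abs_nonneg _) hn
              rw [norm_sub_rev, ← sub_sub, ← mul_pow]
              exact (Complex.norm_exp_sub_one_sub_id_le (h2.trans h3)).trans (by gcongr)
          _ ≤ (∑' m, p m ^ 2) * |u / s n| ^ 2 := by
              rw [← sum_mul]
              gcongr
              exact hp2.sum_le_tsum _ fun _ _ ↦ sq_nonneg _
    · simpa using (ht.abs.pow 2).const_mul (∑' m, p m ^ 2)
  have hB : Tendsto (fun n ↦ ((∑ m ∈ range n, p m - s n ^ 2 : ℝ) : ℂ) * z n) atTop (𝓝 0) := by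
    refine squeeze_zero_norm' (a := fun n ↦ C * ‖z n‖) ?_ ?_
    · filter_upwards [hC] with n hn
      rw [norm_mul, Complex.norm_real]
      exact mul_le_mul_of_nonneg_right hn (norm_nonneg _)
    · simpa using hz0.norm.const_mul C
  -- Second-order Taylor expansion; the cubic remainder times `s n ^ 2` is still `O(1 / s n)`.
  have hD : Tendsto (fun n ↦ ((s n ^ 2 : ℝ) : ℂ) * (z n - (u / s n : ℝ) * Complex.I)) atTop
      (𝓝 ((-(u ^ 2 / 2) : ℝ) : ℂ)) := by
    rw [← tendsto_sub_nhds_zero_iff]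
    refine squeeze_zero_norm' (a := fun n ↦ |u| ^ 2 * |u / s n|) ?_ ?_
    · filter_upwards [ht1, hs.eventually_gt_atTop 0] with n hn hsn
      have hx : ‖((u / s n : ℝ) : ℂ) * Complex.I‖ = |u / s n| := by simp [abs_div]
      have h1 := Complex.exp_bound (x := ((u / s n : ℝ) : ℂ) * Complex.I) (hx.trans_le hn)
        (n := 3) (by norm_num)
      rw [hx] at h1
      have hsc : (s n : ℂ) ≠ 0 := Complex.ofReal_ne_zero.2 hsn.ne'
      have h2 : ((s n ^ 2 : ℝ) : ℂ) * (z n - (u / s n : ℝ) * Complex.I)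
            - ((-(u ^ 2 / 2) : ℝ) : ℂ)
          = ((s n ^ 2 : ℝ) : ℂ) * (Complex.exp ((u / s n : ℝ) * Complex.I)
            - ∑ m ∈ range 3, (((u / s n : ℝ) : ℂ) * Complex.I) ^ m / m.factorial) := by
        simp only [hz, sum_range_succ, range_zero, sum_empty, mul_pow, Complex.I_sq,
          Nat.factorial]
        push_cast
        field_simp
        ring
      rw [h2, norm_mul, Complex.norm_real, Real.norm_of_nonneg (sq_nonneg _)]
      have h3 : s n ^ 2 * |u / s n| ^ 3 = |u| ^ 2 * |u / s n| := by
        rw [abs_div, abs_of_pos hsn]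
        field_simp
      rw [← h3]
      refine mul_le_mul_of_nonneg_left (h1.trans ?_) (sq_nonneg _)
      refine mul_le_of_le_one_right (by positivity) ?_
      norm_num [Nat.factorial]
    · simpa only [abs_zero, mul_zero] using ht.abs.const_mul (|u| ^ 2)
  have hE : Tendsto (fun n ↦ Complex.exp (-((s n ^ 2 : ℝ) * (u / s n : ℝ) * Complex.I))
      * Complex.exp ((∑ m ∈ range n, p m : ℝ) * z n)) atTop
      (𝓝 (Real.exp (-(u ^ 2 / 2)) : ℂ)) := by
    have h1 := (hB.add hD).cexp
    rw [zero_add, ← Complex.ofReal_exp] at h1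
    refine h1.congr fun n ↦ ?_
    rw [← Complex.exp_add]
    congr 1
    push_cast
    ring
  have hF : Tendsto (fun n ↦ Complex.exp (-((s n ^ 2 : ℝ) * (u / s n : ℝ) * Complex.I))
      * (∏ m ∈ range n, (1 + (p m : ℂ) * z n)
        - Complex.exp ((∑ m ∈ range n, p m : ℝ) * z n))) atTop (𝓝 0) := by
    refine squeeze_zero_norm (fun n ↦ ?_) (tendsto_zero_iff_norm_tendsto_zero.1 hA)
    rw [norm_mul, show -(((s n ^ 2 : ℝ) : ℂ) * (u / s n : ℝ) * Complex.I)
      = ((-(s n ^ 2 * (u / s n)) : ℝ) : ℂ) * Complex.I by push_cast; ring,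
      Complex.norm_exp_ofReal_mul_I, one_mul]
  have := hE.add hF
  rw [add_zero] at this
  refine this.congr fun n ↦ ?_
  ring

/-! ### Local limit theorem for the tilted first-kind numbers. -/

-- The left side is the generating polynomial at `a * exp (i t)` divided by its value at `a`; each
-- linear factor becomes a Bernoulli characteristic function.
open Finset in
theorem sum_tilted_rStirlingFirst_mul_cexp_pow {a r : ℝ} (ha : 0 < a) (hr : 0 ≤ r) (n : ℕ) (t : ℝ) :
    ∑ l ∈ range (n + 1), ((rStirlingFirst r n l * a ^ l / ∏ m ∈ range n, (a + r + m) : ℝ) : ℂ)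
        * Complex.exp (t * Complex.I) ^ l
      = ∏ m ∈ range n, (1 + ((a * (1 / (a + r + m)) : ℝ) : ℂ)
          * (Complex.exp (t * Complex.I) - 1)) := by
  have h1 : ∀ m : ℕ, 1 + ((a * (1 / (a + r + m)) : ℝ) : ℂ) * (Complex.exp (t * Complex.I) - 1)
      = (a * Complex.exp (t * Complex.I) + r + m) / ((a + r + m : ℝ) : ℂ) := by
    intro m
    have : ((a + r + m : ℝ) : ℂ) ≠ 0 := Complex.ofReal_ne_zero.2 (by positivity)
    rw [eq_div_iff this, Complex.ofReal_mul, Complex.ofReal_div, add_mul, mul_right_comm,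
      mul_assoc (a : ℂ), div_mul_cancel₀ _ this]
    push_cast
    ring
  simp_rw [h1]
  rw [prod_div_distrib, ← sum_rStirlingFirst_mul_pow, sum_div]
  refine sum_congr rfl fun l _ ↦ ?_
  push_cast
  ring

open Finset Filter Topology in
theorem tendsto_sqrt_mul_log_atTop {a : ℝ} (ha : 0 < a) :
    Tendsto (fun n : ℕ ↦ Real.sqrt (a * Real.log n)) atTop atTop :=
  Real.tendsto_sqrt_atTop.comp
    ((Real.tendsto_log_atTop.comp tendsto_natCast_atTop_atTop).const_mul_atTop ha)

open Finset Filter Topology in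
/-- The local limit theorem for the tilted `r`-Stirling numbers of the first kind. -/
theorem exists_localLimit_bound_rStirlingFirst {a r : ℝ} (ha : 0 < a) (hr : 0 ≤ r) :
    ∃ ε : ℕ → ℝ, Tendsto ε atTop (𝓝 0) ∧ ∀ᶠ n : ℕ in atTop, ∀ j : ℤ,
      |Real.sqrt (a * Real.log n) * (∑ l ∈ range (n + 1), if (l : ℤ) = j then
          rStirlingFirst r n l * a ^ l / ∏ m ∈ range n, (a + r + m) else 0)
        - Real.exp (-(((j - Real.sqrt (a * Real.log n) ^ 2) / Real.sqrt (a * Real.log n)) ^ 2 / 2))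
          / Real.sqrt (2 * Real.pi)| ≤ ε n := by
  have hc : 0 < a + r := by positivity
  obtain ⟨C, hC0, hC⟩ := exists_abs_sum_one_div_add_sub_log_le hc
  have hV := summable_one_div_add_natCast_sq (a + r)
  set V : ℝ := ∑' m : ℕ, (1 / (a + r + m)) ^ 2 with hVdef
  have hs := tendsto_sqrt_mul_log_atTop ha
  have hs2 : ∀ n : ℕ, Real.sqrt (a * Real.log n) ^ 2 = a * Real.log n := fun n ↦
    Real.sq_sqrt (mul_nonneg ha.le (Real.log_natCast_nonneg n))
  have hp0 : ∀ m : ℕ, 0 ≤ a * (1 / (a + r + m)) := fun m ↦ by positivity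
  have hp1 : ∀ m : ℕ, a * (1 / (a + r + m)) ≤ 1 := fun m ↦ by
    rw [mul_one_div, div_le_one (by positivity)]
    have : (0 : ℝ) ≤ m := Nat.cast_nonneg m
    linarith
  have hsum : ∀ᶠ n : ℕ in atTop, |∑ m ∈ range n, a * (1 / (a + r + m))
      - Real.sqrt (a * Real.log n) ^ 2| ≤ a * C := by
    filter_upwards [eventually_ge_atTop 1] with n hn
    rw [hs2, ← mul_sum, ← mul_sub, abs_mul, abs_of_pos ha]
    exact mul_le_mul_of_nonneg_left (hC n hn) ha.le
  -- `δ` is the product of `1 / 2`, from variance at least `s ^ 2 / 2` for large `n`, and `2 / π ^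
  -- 2`, from `1 - cos t ≥ 2 t ^ 2 / π ^ 2` on `[-π, π]`.
  refine exists_localLimit_bound
    (c := fun n l ↦ rStirlingFirst r n l * a ^ l / ∏ m ∈ range n, (a + r + m))
    (N := fun n ↦ n + 1) (μ := fun n : ℕ ↦ Real.sqrt (a * Real.log n) ^ 2)
    (δ := 1 / Real.pi ^ 2) (by positivity) hs ?_ ?_
  -- The variance is at least `s ^ 2 - (a * C + a ^ 2 * V)`; this threshold makes the subtracted
  -- constant at most `s ^ 2 / 2`.
  · have hlarge := hs.eventually_ge_atTop (2 * (a * C + a ^ 2 * V) + 1)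
    filter_upwards [hsum, hlarge] with n hn hl t ht
    rw [sum_tilted_rStirlingFirst_mul_cexp_pow ha hr, norm_prod]
    have h1 : ∏ m ∈ range n, ‖1 + ((a * (1 / (a + r + m)) : ℝ) : ℂ)
          * (Complex.exp (t * Complex.I) - 1)‖
        ≤ ∏ m ∈ range n, Real.exp (-(a * (1 / (a + r + m)) * (1 - a * (1 / (a + r + m)))
          * (1 - Real.cos t))) :=
      prod_le_prod (fun _ _ ↦ norm_nonneg _) fun m _ ↦ norm_one_add_mul_cexp_sub_one_le _ _
    refine h1.trans ?_
    rw [← Real.exp_sum, Real.exp_le_exp, sum_neg_distrib, neg_mul, neg_le_neg_iff, ← sum_mul]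
    set s := Real.sqrt (a * Real.log n) with hsdef
    have hV0 : 0 ≤ V := tsum_nonneg fun _ ↦ sq_nonneg _
    have h2 : s ^ 2 / 2 ≤ ∑ m ∈ range n, a * (1 / (a + r + m)) * (1 - a * (1 / (a + r + m))) := by
      have h3 : ∑ m ∈ range n, a * (1 / (a + r + m)) * (1 - a * (1 / (a + r + m)))
          = ∑ m ∈ range n, a * (1 / (a + r + m))
            - a ^ 2 * ∑ m ∈ range n, (1 / (a + r + m)) ^ 2 := by
        rw [mul_sum, ← sum_sub_distrib]
        exact sum_congr rfl fun m _ ↦ by ring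
      have h4 : a ^ 2 * ∑ m ∈ range n, (1 / (a + r + m)) ^ 2 ≤ a ^ 2 * V :=
        mul_le_mul_of_nonneg_left (hV.sum_le_tsum _ fun _ _ ↦ sq_nonneg _) (sq_nonneg a)
      have h5 := (abs_le.1 hn).1
      have h6 : 0 ≤ a * C + a ^ 2 * V := by positivity
      rw [h3]
      nlinarith
    have h7 : 2 / Real.pi ^ 2 * t ^ 2 ≤ 1 - Real.cos t := by
      linarith [Real.cos_le_one_sub_mul_cos_sq ht]
    calc 1 / Real.pi ^ 2 * (s * t) ^ 2 = s ^ 2 / 2 * (2 / Real.pi ^ 2 * t ^ 2) := by ring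
      _ ≤ _ := mul_le_mul h2 h7 (by positivity) ((by positivity : 0 ≤ s ^ 2 / 2).trans h2)
  · intro u
    have hp2 : Summable fun m : ℕ ↦ (a * (1 / (a + r + m))) ^ 2 :=
      (hV.mul_left (a ^ 2)).congr fun m ↦ by ring
    refine (tendsto_prod_bernoulli_charFun hp0 hp1 hp2 hs hsum u).congr fun n ↦ ?_
    rw [sum_tilted_rStirlingFirst_mul_cexp_pow ha hr]

/-! ### Comparison of the `r`-Lah weights with the tilted weights. -/

-- Since `x + m ≤ (b + m) (1 - 1 / (b + m))`, the quotient of the products is at most `exp (-∑ 1 /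
-- (b + m))`, which is `O(1 / n)`. The constant does not depend on `x`.
open Finset in
theorem exists_prod_div_prod_le {b : ℝ} (hb : 0 < b) :
    ∃ K : ℝ, 0 ≤ K ∧ ∀ x : ℝ, 0 ≤ x → x + 1 ≤ b → ∀ n : ℕ, 1 ≤ n →
      ∏ m ∈ range n, (x + m) ≤ K / n * ∏ m ∈ range n, (b + m) := by
  obtain ⟨C, hC0, hC⟩ := exists_abs_sum_one_div_add_sub_log_le hb
  refine ⟨Real.exp C, (Real.exp_pos C).le, fun x hx hxb n hn ↦ ?_⟩
  have hn0 : (0 : ℝ) < n := by exact_mod_cast hn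
  have hexp : Real.exp (-∑ m ∈ range n, 1 / (b + m)) ≤ Real.exp C / n := by
    rw [← Real.exp_log hn0, ← Real.exp_sub, Real.exp_le_exp]
    linarith [(abs_le.1 (hC n hn)).1]
  calc ∏ m ∈ range n, (x + m) ≤ ∏ m ∈ range n, (Real.exp (-(1 / (b + m))) * (b + m)) := by
        refine prod_le_prod (fun m _ ↦ by positivity) fun m _ ↦ ?_
        have hbm : 0 < b + m := by positivity
        have h1 := Real.add_one_le_exp (-(1 / (b + m)))
        calc x + m ≤ (-(1 / (b + m)) + 1) * (b + m) := by
              rw [add_mul, neg_mul, one_div_mul_cancel hbm.ne']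
              linarith
          _ ≤ _ := mul_le_mul_of_nonneg_right h1 hbm.le
    _ = Real.exp (-∑ m ∈ range n, 1 / (b + m)) * ∏ m ∈ range n, (b + m) := by
        rw [prod_mul_distrib, ← Real.exp_sum, sum_neg_distrib]
    _ ≤ _ := by gcongr

/-- Stability of a quotient: `E ≤ W / 2` keeps `D` above `W / 2`, and `y ≤ W` keeps the effect of
the denominator's error of order `E / W`. -/
theorem abs_div_sub_div_le {x y D W E : ℝ} (hy : 0 ≤ y) (hyW : y ≤ W) (hW : 0 < W)
    (hxy : |x - y| ≤ E) (hDW : |D - W| ≤ E) (hE : E ≤ W / 2) :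
    |x / D - y / W| ≤ 4 * (E / W) := by
  have hD : W / 2 ≤ D := by linarith [(abs_le.1 hDW).1]
  have hD0 : 0 < D := by linarith
  have hE0 : 0 ≤ E := (abs_nonneg _).trans hxy
  have h1 : x / D - y / W = (x - y) / D - y / W * ((D - W) / D) := by
    field_simp
    ring
  have h2 : ∀ z : ℝ, |z| ≤ E → |z / D| ≤ 2 * (E / W) := fun z hz ↦ by
    rw [abs_div, abs_of_pos hD0, div_le_iff₀ hD0]
    calc |z| ≤ 2 * (E / W) * (W / 2) := by field_simp; linarith
      _ ≤ _ := by gcongr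
  have h3 : |y / W * ((D - W) / D)| ≤ 1 * (2 * (E / W)) := by
    rw [abs_mul, abs_of_nonneg (div_nonneg hy hW.le)]
    exact mul_le_mul ((div_le_one hW).2 hyW) (h2 _ hDW) (abs_nonneg _) zero_le_one
  rw [h1]
  linarith [abs_sub ((x - y) / D) (y / W * ((D - W) / D)), h2 _ hxy]

open Finset Filter in
/-- The `r`-Lah distribution is close to a tilted `r`-Stirling distribution of the first kind. -/
theorem exists_rLah_sub_tilted_le (k : ℕ) {r : ℝ} (hr : 0 ≤ r) (hkr : 0 < (k : ℝ) + r) :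
    ∃ K : ℝ, ∀ᶠ n : ℕ in atTop, ∀ j : ℕ,
      |rStirlingFirst r n j * rStirlingSecond r j k / rLahNumber r n k
        - rStirlingFirst r n j * (k + r) ^ j / ∏ m ∈ range n, ((k + r : ℝ) + r + m)| ≤ K / n := by
  obtain ⟨K, hK0, hK⟩ := exists_prod_div_prod_le (b := (k + r : ℝ) + r) (by positivity)
  have hlarge : ∀ᶠ n : ℕ in atTop, 2 * (2 ^ k * K) ≤ (n : ℝ) :=
    tendsto_natCast_atTop_atTop.eventually_ge_atTop _
  refine ⟨4 * (2 ^ k * K), ?_⟩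
  filter_upwards [hlarge, eventually_ge_atTop 1] with n hn hn1 j
  have hn0 : (0 : ℝ) < n := by exact_mod_cast hn1
  set W : ℝ := ∏ m ∈ range n, ((k + r : ℝ) + r + m) with hWdef
  have hW : 0 < W := prod_pos fun m _ ↦ by positivity
  -- A common bound for the terms `i < k` in numerator and denominator; `2 ^ k` is the sum of the
  -- binomial coefficients.
  set E : ℝ := 2 ^ k * K / n * W with hEdef
  have hsmall : ∀ i ∈ range k, ∏ m ∈ range n, ((i + r : ℝ) + r + m) ≤ K / n * W := by
    intro i hi
    refine hK ((i + r : ℝ) + r) (by positivity) ?_ n hn1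
    have : (i : ℝ) + 1 ≤ k := by exact_mod_cast mem_range.1 hi
    linarith
  have hE : ∑ i ∈ range k, (k.choose i : ℝ) * ∏ m ∈ range n, ((i + r : ℝ) + r + m) ≤ E := by
    calc ∑ i ∈ range k, (k.choose i : ℝ) * ∏ m ∈ range n, ((i + r : ℝ) + r + m)
        ≤ ∑ i ∈ range k, (k.choose i : ℝ) * (K / n * W) :=
          sum_le_sum fun i hi ↦ mul_le_mul_of_nonneg_left (hsmall i hi) (Nat.cast_nonneg _)
      _ ≤ ∑ i ∈ range (k + 1), (k.choose i : ℝ) * (K / n * W) :=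
          sum_le_sum_of_subset_of_nonneg (range_mono k.le_succ) fun _ _ _ ↦ by positivity
      _ = E := by
          have h2 : ∑ i ∈ range (k + 1), (k.choose i : ℝ) = 2 ^ k := by
            exact_mod_cast Nat.sum_range_choose k
          rw [← sum_mul, h2, hEdef]
          ring
  -- A single term of a polynomial with nonnegative coefficients is at most its value, which makes
  -- the estimate uniform in `j`.
  have hterm : ∀ (x : ℝ) (i : ℕ), 0 ≤ i + x → rStirlingFirst r n j * (i + x) ^ j
      ≤ ∏ m ∈ range n, ((i + x : ℝ) + r + m) := by
    intro x i hx
    rw [← sum_rStirlingFirst_mul_pow_real]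
    rcases Nat.lt_or_ge n j with h | h
    · rw [rStirlingFirst_eq_zero_of_lt r h, zero_mul]
      exact sum_nonneg fun l _ ↦ mul_nonneg (rStirlingFirst_nonneg hr _ _) (pow_nonneg hx l)
    · exact single_le_sum (f := fun l ↦ rStirlingFirst r n l * (i + x : ℝ) ^ l)
        (fun l _ ↦ mul_nonneg (rStirlingFirst_nonneg hr _ _) (pow_nonneg hx l))
        (mem_range.2 (Nat.lt_succ_of_le h))
  have hsign : ∀ g : ℕ → ℝ, |∑ i ∈ range k, (-1) ^ (k + i) * (k.choose i : ℝ) * g i|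
      ≤ ∑ i ∈ range k, (k.choose i : ℝ) * |g i| := fun g ↦
    (abs_sum_le_sum_abs _ _).trans_eq (sum_congr rfl fun i _ ↦ by
      rw [abs_mul, abs_mul, abs_pow, abs_neg, abs_one, one_pow, one_mul, Nat.abs_cast])
  have htop : (-1 : ℝ) ^ (k + k) * (k.choose k : ℝ) = 1 := by
    rw [← two_mul, pow_mul]
    simp
  have hfac : (k.factorial : ℝ) ≠ 0 := by positivity
  have hx : |rStirlingFirst r n j * (k.factorial * rStirlingSecond r j k)
      - rStirlingFirst r n j * (k + r) ^ j| ≤ E := by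
    rw [factorial_mul_rStirlingSecond, sum_range_succ, htop, one_mul, mul_add, add_sub_cancel_right,
      mul_sum]
    simp_rw [mul_left_comm (rStirlingFirst r n j)]
    refine ((hsign _).trans (sum_le_sum fun i _ ↦ ?_)).trans hE
    rw [abs_of_nonneg (mul_nonneg (rStirlingFirst_nonneg hr _ _) (by positivity))]
    exact mul_le_mul_of_nonneg_left (hterm r i (by positivity)) (Nat.cast_nonneg _)
  have hD : |k.factorial * rLahNumber r n k - W| ≤ E := by
    rw [factorial_mul_rLahNumber, sum_range_succ, htop, one_mul, add_sub_cancel_right]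
    refine ((hsign _).trans (sum_le_sum fun i _ ↦ ?_)).trans hE
    rw [abs_of_nonneg (prod_nonneg fun m _ ↦ by positivity)]
  have hEW : E ≤ W / 2 := by
    have : 2 ^ k * K / n ≤ 1 / 2 := by
      rw [div_le_iff₀ hn0]
      linarith
    rw [hEdef]
    nlinarith
  have hmain := abs_div_sub_div_le (mul_nonneg (rStirlingFirst_nonneg hr n j) (by positivity))
    (hterm r k hkr.le) hW hx hD hEW
  rw [mul_left_comm, mul_div_mul_left _ _ hfac] at hmain
  refine hmain.trans_eq ?_
  rw [hEdef, mul_div_cancel_right₀ _ hW.ne']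
  ring

/-! ### Conclusion. -/

open Finset Filter Topology in
theorem tendsto_sqrt_log_mul_const_div (K : ℝ) :
    Tendsto (fun n : ℕ ↦ Real.sqrt (Real.log n) * (K / n)) atTop (𝓝 0) := by
  have h1 : Tendsto (fun x : ℝ ↦ Real.log x / x) atTop (𝓝 0) :=
    Real.isLittleO_log_id_atTop.tendsto_div_nhds_zero
  have h2 := (h1.comp tendsto_natCast_atTop_atTop).mul_const |K|
  rw [zero_mul] at h2
  refine squeeze_zero_norm' ?_ h2
  filter_upwards [(Real.tendsto_log_atTop.comp
    tendsto_natCast_atTop_atTop).eventually_ge_atTop 1] with n hn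
  simp only [Function.comp_apply] at hn ⊢
  rw [norm_mul, Real.norm_of_nonneg (Real.sqrt_nonneg _), norm_div, Real.norm_natCast,
    Real.norm_eq_abs]
  have h3 : Real.sqrt (Real.log n) ≤ Real.log n := by
    rw [Real.sqrt_le_left (by linarith)]
    nlinarith
  calc Real.sqrt (Real.log n) * (|K| / n) ≤ Real.log n * (|K| / n) := by gcongr
    _ = _ := by ring

theorem mainTheorem9 (k : ℕ) (r : ℝ) (hr : 0 ≤ r) (hkr : 0 < max (k : ℝ) r)
    {Ω : ℕ → Type*} [∀ n, MeasurableSpace (Ω n)]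
    (P : ∀ n, MeasureTheory.Measure (Ω n)) [∀ n, MeasureTheory.IsProbabilityMeasure (P n)]
    (Lah : ∀ n, Ω n → ℤ)
    (hLah : ∀ n, 1 ≤ n → k ≤ n → ProbabilityTheory.HasLaw (Lah n) (rLahMeasure n k r) (P n)) :
    Filter.Tendsto
      (fun n : ℕ ↦ Real.sqrt (Real.log n) *
        ⨆ j : ℤ, |(P n).real {ω | Lah n ω = j} -
          Real.exp (-(((j : ℝ) - (k + r) * Real.log n) ^ 2 / (2 * (k + r) * Real.log n))) /
            Real.sqrt (2 * Real.pi * (k + r) * Real.log n)|)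
      Filter.atTop (nhds 0) := by
  have ha : 0 < (k : ℝ) + r := by
    rcases lt_max_iff.1 hkr with h | h
    · linarith
    · have : (0 : ℝ) ≤ k := Nat.cast_nonneg k
      linarith
  obtain ⟨ε, hε, hllt⟩ := exists_localLimit_bound_rStirlingFirst ha hr
  obtain ⟨K, hK⟩ := exists_rLah_sub_tilted_le k hr ha
  have hlog := Real.tendsto_log_atTop.comp (tendsto_natCast_atTop_atTop (R := ℝ))
  -- The local limit error is `ε n / s` with `s = √((k + r) log n)`, so multiplying by `√(log n)`
  -- leaves `ε n / √(k + r)`.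
  have hbd : Filter.Tendsto (fun n : ℕ ↦ ε n / Real.sqrt (k + r) + Real.sqrt (Real.log n) * (K / n))
      Filter.atTop (nhds 0) := by
    simpa using (hε.div_const (Real.sqrt (k + r))).add (tendsto_sqrt_log_mul_const_div K)
  refine squeeze_zero' (Filter.Eventually.of_forall fun n ↦ mul_nonneg (Real.sqrt_nonneg _)
    (Real.iSup_nonneg fun j ↦ abs_nonneg _)) ?_ hbd
  filter_upwards [hllt, hK, hlog.eventually_gt_atTop 0, Filter.eventually_ge_atTop 1,
    Filter.eventually_ge_atTop k] with n h1 h2 hl hn1 hnk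
  simp only [Function.comp_apply] at hl
  have hsl : 0 < Real.sqrt (Real.log n) := Real.sqrt_pos.2 hl
  have hsa : 0 < Real.sqrt (k + r) := Real.sqrt_pos.2 ha
  have hs : Real.sqrt ((k + r) * Real.log n) = Real.sqrt (k + r) * Real.sqrt (Real.log n) :=
    Real.sqrt_mul ha.le _
  set s := Real.sqrt ((k + r) * Real.log n) with hsdef
  have hs0 : 0 < s := by rw [hs]; positivity
  have hs2 : s ^ 2 = (k + r) * Real.log n := Real.sq_sqrt (by positivity)
  have hsup : (⨆ j : ℤ, |(P n).real {ω | Lah n ω = j} -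
          Real.exp (-(((j : ℝ) - (k + r) * Real.log n) ^ 2 / (2 * (k + r) * Real.log n))) /
            Real.sqrt (2 * Real.pi * (k + r) * Real.log n)|) ≤ ε n / s + K / n := by
    refine ciSup_le fun j ↦ ?_
    have hlaw : (P n).real {ω | Lah n ω = j} = (rLahMeasure n k r).real {j} := by
      have := (hLah n hn1 hnk).measure_eq (p := fun i ↦ i = j) (MeasurableSet.of_discrete)
      simp only [MeasureTheory.Measure.real, this, Set.ofPred_eq_eq_singleton]
    set q : ℝ := ∑ l ∈ Finset.range (n + 1), if (l : ℤ) = j then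
      rStirlingFirst r n l * (k + r) ^ l / ∏ m ∈ Finset.range n, ((k + r : ℝ) + r + m) else 0
      with hq
    have hclose : |(rLahMeasure n k r).real {j} - q| ≤ K / n := by
      rcases lt_or_ge j 0 with hj | hj
      · have hq0 : q = 0 := Finset.sum_eq_zero fun l _ ↦ if_neg (by omega)
        rw [rLahMeasure_real_singleton_of_neg n k r hj, hq0, sub_zero, abs_zero]
        -- Only `0 ≤ K / n` is needed; the comparison at index `0` provides it.
        exact (abs_nonneg _).trans (h2 0)
      · lift j to ℕ using hj
        have hqj : q = rStirlingFirst r n j * (k + r) ^ j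
            / ∏ m ∈ Finset.range n, ((k + r : ℝ) + r + m) := by
          simp only [hq, Nat.cast_inj, Finset.sum_ite_eq', Finset.mem_range]
          split_ifs with h
          · rfl
          · rw [rStirlingFirst_eq_zero_of_lt r (by omega), zero_mul, zero_div]
        rw [rLahMeasure_real_singleton_natCast hr, hqj]
        exact h2 j
    have hgauss : Real.exp (-(((j : ℝ) - (k + r) * Real.log n) ^ 2 / (2 * (k + r) * Real.log n))) /
            Real.sqrt (2 * Real.pi * (k + r) * Real.log n)
        = Real.exp (-((((j : ℝ) - s ^ 2) / s) ^ 2 / 2)) / Real.sqrt (2 * Real.pi) / s := by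
      rw [mul_assoc (2 * Real.pi), Real.sqrt_mul (by positivity), ← hsdef, div_div, div_pow, hs2,
        div_div]
      congr 4
      ring
    have hloc : |q - Real.exp (-((((j : ℝ) - s ^ 2) / s) ^ 2 / 2)) / Real.sqrt (2 * Real.pi) / s|
        ≤ ε n / s := by
      rw [le_div_iff₀ hs0]
      refine le_of_eq_of_le ?_ (h1 j)
      rw [← abs_of_pos hs0, ← abs_mul, abs_of_pos hs0, sub_mul, div_mul_cancel₀ _ hs0.ne',
        mul_comm q]
    rw [hlaw, hgauss]
    linarith [abs_sub_le ((rLahMeasure n k r).real {j}) q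
      (Real.exp (-((((j : ℝ) - s ^ 2) / s) ^ 2 / 2)) / Real.sqrt (2 * Real.pi) / s)]
  calc _ ≤ Real.sqrt (Real.log n) * (ε n / s + K / n) := mul_le_mul_of_nonneg_left hsup hsl.le
    _ = _ := by
      rw [hs]
      field_simp
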